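/- For $\tau$ in the upper half-plane $\mathfrak H$ put $q=e^{2\pi i\tau}$, and let $$E_4(\tau)=1+240\sum_{n\ge 1}\sigma_3(n)q^n,\qquad \eta(\tau)=q^{1/24}\prod_{n\ge 1}(1-q^n),\qquad j(\tau)=\frac{E_4(\tau)^3}{\eta(\tau)^{24}},$$ where $\sigma_3(n)=\sum_{d\mid n}d^3$ and $q^{1/24}=e^{2\pi i\tau/24}$. Let $c_n$ be the Fourier coefficients of the elliptic modular function $j$, so that $$j(\tau)=\frac1q+744+\sum_{n=1}^{\infty}c_nq^n\qquad(\tau\in\mathfrak H).$$ Then $$c_n\sim\frac{e^{4\pi\sqrt n}}{\sqrt2\,n^{3/4}}\qquad(n\to\infty).$$ -/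

import Mathlib

noncomputable section

open UpperHalfPlane

/-- The parameter `q = e^{2πiτ}`. -/
def modularQ (τ : ℍ) : ℂ := Complex.exp (2 * Real.pi * Complex.I * (τ : ℂ))

/-- The elliptic modular function `j = E₄³ / η²⁴`. -/
def kleinJ (τ : ℍ) : ℂ := ModularForm.E₄ τ ^ 3 / ModularForm.eta (τ : ℂ) ^ 24

/-- The `n`-th Fourier coefficient of `j`. Since `j` has a simple pole at `q = 0`, it is read off
as the coefficient of `q ^ (n + 1)` in the Taylor expansion at `q = 0` of `q * j`. -/
def kleinJCoeff (n : ℕ) : ℂ :=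
  (qExpansion 1 (fun τ : ℍ => modularQ τ * kleinJ τ)).coeff (n + 1)

/-- The `q`-expansion `E₄ = 1 + 240 ∑_{n ≥ 1} σ₃(n) qⁿ` of Mathlib's Eisenstein series. -/
theorem E4_eq_tsum (τ : ℍ) : ModularForm.E₄ τ =
    1 + 240 * ∑' n : ℕ+, (ArithmeticFunction.sigma 3 n : ℂ) * modularQ τ ^ (n : ℕ) := by
  have h := EisensteinSeries.q_expansion_bernoulli (k := 4) (by norm_num) (by decide) τ
  have hb : bernoulli 4 = -1 / 30 := by
    rw [bernoulli_eq_bernoulli'_of_ne_one (by norm_num), bernoulli'_four]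
  rw [h, hb]
  simp only [modularQ, zpow_natCast]
  push_cast
  norm_num

end

open UpperHalfPlane Filter MeasureTheory
open scoped Manifold Topology MatrixGroups

theorem kleinJ_eq_div_discriminant (τ : ℍ) :
    kleinJ τ = ModularForm.E₄ τ ^ 3 / ModularForm.discriminant τ := rfl

theorem modularQ_eq_qParam (τ : ℍ) : modularQ τ = Function.Periodic.qParam 1 τ := by
  simp [modularQ, Function.Periodic.qParam]

theorem modularQ_ne_zero (τ : ℍ) : modularQ τ ≠ 0 := Complex.exp_ne_zero _

theorem norm_modularQ (τ : ℍ) : ‖modularQ τ‖ = Real.exp (-2 * Real.pi * τ.im) := by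
  simp [modularQ, Complex.norm_exp]

theorem kleinJ_smul (γ : SL(2, ℤ)) (τ : ℍ) : kleinJ (γ • τ) = kleinJ τ := by
  have h4 : ModularForm.E₄ (γ • τ) = denom γ τ ^ (4 : ℤ) * ModularForm.E₄ τ :=
    SlashInvariantForm.slash_action_eqn'' (Γ := 𝒮ℒ) ModularForm.E₄
      (MonoidHom.mem_range.2 ⟨γ, rfl⟩) τ
  have h12 : ModularForm.discriminant (γ • τ) =
      denom γ τ ^ (12 : ℤ) * ModularForm.discriminant τ :=
    SlashInvariantForm.slash_action_eqn'' (Γ := 𝒮ℒ) CuspForm.discriminant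
      (MonoidHom.mem_range.2 ⟨γ, rfl⟩) τ
  have hd : denom γ τ ≠ 0 := denom_ne_zero _ _
  rw [kleinJ_eq_div_discriminant, kleinJ_eq_div_discriminant, h4, h12]
  have := ModularForm.discriminant_ne_zero τ
  field_simp

/-- The function `q * j`, which is holomorphic at the cusp. -/
noncomputable abbrev modularQMulKleinJ (τ : ℍ) : ℂ := modularQ τ * kleinJ τ

theorem mdifferentiable_modularQMulKleinJ : MDiff modularQMulKleinJ := by
  rw [UpperHalfPlane.mdifferentiable_iff]
  have hE := UpperHalfPlane.mdifferentiable_iff.1 ModularForm.E₄.holo'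
  have hD := UpperHalfPlane.mdifferentiable_iff.1 CuspForm.discriminant.holo'
  have hq : DifferentiableOn ℂ (fun z => Complex.exp (2 * Real.pi * Complex.I * z))
      {z | 0 < z.im} := by
    fun_prop
  refine (hq.mul ((hE.pow 3).div hD fun z _ => ModularForm.discriminant_ne_zero _)).congr ?_
  intro z hz
  simp [modularQMulKleinJ, modularQ, kleinJ_eq_div_discriminant, ofComplex_apply_of_im_pos hz]

theorem modularQ_vadd_one (τ : ℍ) : modularQ ((1 : ℝ) +ᵥ τ) = modularQ τ := by
  simp [modularQ, mul_add, Complex.exp_add]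

theorem kleinJ_vadd_one (τ : ℍ) : kleinJ ((1 : ℝ) +ᵥ τ) = kleinJ τ := by
  rw [← kleinJ_smul ModularGroup.T τ, modular_T_smul]

theorem periodic_modularQMulKleinJ :
    Function.Periodic (modularQMulKleinJ ∘ ofComplex) (1 : ℝ) := by
  intro w
  by_cases! hw : 0 < w.im
  · have h1 : 0 < (w + (1 : ℝ)).im := by simpa using hw
    have h2 : (⟨w + (1 : ℝ), h1⟩ : ℍ) = (1 : ℝ) +ᵥ (⟨w, hw⟩ : ℍ) := by
      ext; simp [add_comm]
    simp only [Function.comp_apply, ofComplex_apply_of_im_pos h1, ofComplex_apply_of_im_pos hw,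
      modularQMulKleinJ, h2, modularQ_vadd_one, kleinJ_vadd_one]
  · have : (w + (1 : ℝ)).im ≤ 0 := by simpa using hw
    simp only [Function.comp_apply, ofComplex_apply_of_im_nonpos this,
      ofComplex_apply_of_im_nonpos hw]

theorem isBoundedAtImInfty_modularQMulKleinJ : IsBoundedAtImInfty modularQMulKleinJ := by
  have hE : IsBoundedAtImInfty ModularForm.E₄ := ModularFormClass.bdd_at_infty ModularForm.E₄
  have hP : Filter.Tendsto (fun τ : ℍ => (∏' n : ℕ, (1 - ModularForm.eta_q n τ) ^ 24)⁻¹) atImInfty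
      (𝓝 1) := by
    simpa using ModularForm.tendsto_atImInfty_tprod_one_sub_eta_q_pow.inv₀ one_ne_zero
  have h := (Asymptotics.IsBigO.pow hE 3).mul (hP.isBigO_one ℝ)
  have hfun : modularQMulKleinJ = fun τ : ℍ =>
      ModularForm.E₄ τ ^ 3 * (∏' n : ℕ, (1 - ModularForm.eta_q n τ) ^ 24)⁻¹ := by
    funext τ
    have := modularQ_ne_zero τ
    rw [modularQMulKleinJ, kleinJ_eq_div_discriminant, ModularForm.discriminant_eq_q_prod,
      ← modularQ_eq_qParam]
    field_simp
  unfold IsBoundedAtImInfty Filter.BoundedAtFilter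
  rw [hfun]
  refine h.congr_right fun τ => ?_
  simp

theorem analyticAt_cuspFunction_modularQMulKleinJ :
    AnalyticAt ℂ (cuspFunction 1 modularQMulKleinJ) 0 :=
  analyticAt_cuspFunction_zero one_pos periodic_modularQMulKleinJ
    mdifferentiable_modularQMulKleinJ isBoundedAtImInfty_modularQMulKleinJ

theorem E₄_qExpansion_coeff_two : (qExpansion 1 ModularForm.E₄).coeff 2 = 2160 := by
  have hb : bernoulli 4 = -1 / 30 := by
    rw [bernoulli_eq_bernoulli'_of_ne_one (by norm_num), bernoulli'_four]
  have hs : ArithmeticFunction.sigma 3 2 = 9 := by decide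
  rw [EisensteinSeries.E_qExpansion_coeff _ ⟨2, rfl⟩, hb]
  norm_num [hs]

theorem E₆_qExpansion_coeff_two : (qExpansion 1 ModularForm.E₆).coeff 2 = -16632 := by
  have hb : bernoulli 6 = 1 / 42 := by
    rw [bernoulli_eq_bernoulli'_of_ne_one (by norm_num), bernoulli'_def]
    simp [Finset.sum_range_succ, Nat.choose, bernoulli'_def 5, bernoulli'_four]
    norm_num
  have hs : ArithmeticFunction.sigma 5 2 = 33 := by decide
  rw [EisensteinSeries.E_qExpansion_coeff _ ⟨3, rfl⟩, hb]
  norm_num [hs]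

theorem discriminant_qExpansion_eq : qExpansion 1 ModularForm.discriminant =
    (1 / 1728 : ℂ) • (qExpansion 1 ModularForm.E₄ ^ 3 - qExpansion 1 ModularForm.E₆ ^ 2) := by
  have h4 := ModularFormClass.analyticAt_cuspFunction_zero (ModularForm.E₄.pow 3) one_pos
    one_mem_strictPeriods_SL
  have h6 := ModularFormClass.analyticAt_cuspFunction_zero (ModularForm.E₆.pow 2) one_pos
    one_mem_strictPeriods_SL
  have hfun : ModularForm.discriminant =
      (1 / 1728 : ℂ) • (⇑(ModularForm.E₄.pow 3) - ⇑(ModularForm.E₆.pow 2)) := by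
    funext τ
    rw [ModularForm.discriminant_eq_E₄_cube_sub_E₆_sq]
    simp only [one_div_mul_eq_div, Pi.smul_apply, Pi.sub_apply, ModularForm.coe_pow, Pi.pow_apply,
      smul_eq_mul]
  rw [hfun, qExpansion_smul, qExpansion_sub h4 h6,
    ModularForm.qExpansion_pow one_pos one_mem_strictPeriods_SL,
    ModularForm.qExpansion_pow one_pos one_mem_strictPeriods_SL]
  rw [cuspFunction_sub h4.continuousAt h6.continuousAt]
  exact h4.sub h6

theorem discriminant_qExpansion_coeff_two :
    (qExpansion 1 ModularForm.discriminant).coeff 2 = -24 := by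
  rw [discriminant_qExpansion_eq, pow_succ, pow_two, pow_two]
  norm_num [PowerSeries.coeff_mul, Finset.Nat.antidiagonal_succ,
    ModularForm.E₄_qExpansion_coeff_one, ModularForm.E₆_qExpansion_coeff_one,
    E₄_qExpansion_coeff_two, E₆_qExpansion_coeff_two,
    EisensteinSeries.E_qExpansion_coeff_zero _ ⟨2, rfl⟩,
    EisensteinSeries.E_qExpansion_coeff_zero _ ⟨3, rfl⟩]

theorem discriminant_qExpansion_coeff_zero :
    (qExpansion 1 ModularForm.discriminant).coeff 0 = 0 :=
  CuspFormClass.qExpansion_coeff_zero CuspForm.discriminant one_pos one_mem_strictPeriods_SL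

theorem hasSum_qExpansion_modularQMulKleinJ (τ : ℍ) :
    HasSum (fun m : ℕ => (qExpansion 1 modularQMulKleinJ).coeff m * modularQ τ ^ m)
      (modularQMulKleinJ τ) := by
  simpa [modularQ_eq_qParam] using hasSum_qExpansion one_pos periodic_modularQMulKleinJ
    mdifferentiable_modularQMulKleinJ isBoundedAtImInfty_modularQMulKleinJ τ

theorem hasSum_coeff_X_mul {p : PowerSeries ℂ} {q a : ℂ}
    (h : HasSum (fun m : ℕ => p.coeff m * q ^ m) a) :
    HasSum (fun m : ℕ => (PowerSeries.X * p).coeff m • q ^ m) (q * a) := by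
  refine (hasSum_nat_add_iff' 1).1 ?_
  simpa [PowerSeries.coeff_succ_X_mul, pow_succ', mul_left_comm] using h.mul_left q

theorem qExpansion_coeff_eq_of_hasSum {f : ℍ → ℂ} {c : ℕ → ℂ}
    (hf : AnalyticAt ℂ (cuspFunction 1 f) 0)
    (h : ∀ τ : ℍ, HasSum (fun m => c m • Function.Periodic.qParam 1 τ ^ m) (f τ)) (m : ℕ) :
    c m = (qExpansion 1 f).coeff m :=
  @qExpansion_coeff_unique (ℍ → ℂ) ⟨fun f => f, fun _ _ h => h⟩ 1 f c one_pos hf h m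

theorem discriminant_qExpansion_mul_eq :
    qExpansion 1 ModularForm.discriminant * qExpansion 1 modularQMulKleinJ =
      PowerSeries.X * qExpansion 1 ModularForm.E₄ ^ 3 := by
  have hΔ : AnalyticAt ℂ (cuspFunction 1 ModularForm.discriminant) 0 :=
    ModularFormClass.analyticAt_cuspFunction_zero CuspForm.discriminant one_pos
      one_mem_strictPeriods_SL
  have hj := analyticAt_cuspFunction_modularQMulKleinJ
  rw [← qExpansion_mul hΔ hj]
  have han : AnalyticAt ℂ (cuspFunction 1 (ModularForm.discriminant * modularQMulKleinJ)) 0 := by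
    rw [cuspFunction_mul hΔ.continuousAt hj.continuousAt]
    exact hΔ.mul hj
  ext m
  refine (qExpansion_coeff_eq_of_hasSum han
    (c := fun m => (PowerSeries.X * qExpansion 1 ModularForm.E₄ ^ 3 : PowerSeries ℂ).coeff m)
    (fun τ => ?_) m).symm
  have hE := ModularForm.hasSum_qExpansion (ModularForm.E₄.pow 3) one_pos
    one_mem_strictPeriods_SL τ
  rw [ModularForm.qExpansion_pow one_pos one_mem_strictPeriods_SL] at hE
  rw [← modularQ_eq_qParam, ModularForm.coe_pow, Pi.pow_apply] at hE
  rw [← modularQ_eq_qParam]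
  have hval : (ModularForm.discriminant * modularQMulKleinJ) τ =
      modularQ τ * ModularForm.E₄ τ ^ 3 := by
    have := ModularForm.discriminant_ne_zero τ
    rw [Pi.mul_apply, modularQMulKleinJ, kleinJ_eq_div_discriminant]
    field_simp
  rw [hval]
  exact hasSum_coeff_X_mul hE

theorem modularQMulKleinJ_qExpansion_coeff_zero :
    (qExpansion 1 modularQMulKleinJ).coeff 0 = 1 := by
  have h := congrArg (PowerSeries.coeff 1) discriminant_qExpansion_mul_eq
  rw [PowerSeries.coeff_succ_X_mul, pow_succ, pow_two] at h
  simpa [-PowerSeries.coeff_zero_eq_constantCoeff, PowerSeries.coeff_mul,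
    Finset.Nat.antidiagonal_succ, discriminant_qExpansion_coeff_zero,
    ModularForm.discriminant_qExpansion_coeff_one,
    EisensteinSeries.E_qExpansion_coeff_zero _ ⟨2, rfl⟩] using h

theorem modularQMulKleinJ_qExpansion_coeff_one :
    (qExpansion 1 modularQMulKleinJ).coeff 1 = 744 := by
  have h := congrArg (PowerSeries.coeff 2) discriminant_qExpansion_mul_eq
  rw [PowerSeries.coeff_succ_X_mul, pow_succ, pow_two] at h
  simp [-PowerSeries.coeff_zero_eq_constantCoeff, PowerSeries.coeff_mul,
    Finset.Nat.antidiagonal_succ, discriminant_qExpansion_coeff_zero,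
    ModularForm.discriminant_qExpansion_coeff_one, discriminant_qExpansion_coeff_two,
    modularQMulKleinJ_qExpansion_coeff_zero, ModularForm.E₄_qExpansion_coeff_one,
    EisensteinSeries.E_qExpansion_coeff_zero _ ⟨2, rfl⟩] at h
  linear_combination h

theorem hasSum_kleinJCoeff (τ : ℍ) :
    HasSum (fun n : ℕ => kleinJCoeff (n + 1) * modularQ τ ^ (n + 1))
      (kleinJ τ - (1 / modularQ τ + 744)) := by
  have hq := modularQ_ne_zero τ
  have h := ((hasSum_nat_add_iff' 2).2 (hasSum_qExpansion_modularQMulKleinJ τ)).mul_left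
    (modularQ τ)⁻¹
  have hfun : (fun n : ℕ => kleinJCoeff (n + 1) * modularQ τ ^ (n + 1)) = fun n : ℕ =>
      (modularQ τ)⁻¹ *
        ((qExpansion 1 modularQMulKleinJ).coeff (n + 2) * modularQ τ ^ (n + 2)) := by
    funext n
    have : kleinJCoeff (n + 1) = (qExpansion 1 modularQMulKleinJ).coeff (n + 2) := rfl
    rw [this]
    field_simp
    ring
  have hval : kleinJ τ - (1 / modularQ τ + 744) = (modularQ τ)⁻¹ * (modularQMulKleinJ τ -
      ∑ i ∈ Finset.range 2, (qExpansion 1 modularQMulKleinJ).coeff i * modularQ τ ^ i) := by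
    rw [Finset.sum_range_succ, Finset.sum_range_one, modularQMulKleinJ_qExpansion_coeff_zero,
      modularQMulKleinJ_qExpansion_coeff_one, modularQMulKleinJ]
    field_simp
  rw [hfun, hval]
  exact h

theorem exists_norm_kleinJ_sub_one_div_modularQ_le :
    ∃ C : ℝ, ∀ τ : ℍ, 1 / 2 ≤ τ.im → ‖kleinJ τ - 1 / modularQ τ‖ ≤ C := by
  let τ₀ : ℍ := ⟨Complex.I / 2, by simp⟩
  have h0 : τ₀.im = 1 / 2 := by
    change (Complex.I / 2).im = 1 / 2
    simp
  have hs := (hasSum_kleinJCoeff τ₀).summable.norm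
  refine ⟨∑' n : ℕ, ‖kleinJCoeff (n + 1) * modularQ τ₀ ^ (n + 1)‖ + 744, fun τ hτ => ?_⟩
  have hq : ‖modularQ τ‖ ≤ ‖modularQ τ₀‖ := by
    rw [norm_modularQ, norm_modularQ, h0, Real.exp_le_exp]
    nlinarith [Real.pi_pos]
  have h := hasSum_kleinJCoeff τ
  have hb : ‖kleinJ τ - (1 / modularQ τ + 744)‖ ≤
      ∑' n : ℕ, ‖kleinJCoeff (n + 1) * modularQ τ₀ ^ (n + 1)‖ := by
    rw [← h.tsum_eq]
    refine tsum_of_norm_bounded hs.hasSum fun n => ?_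
    rw [norm_mul, norm_mul, norm_pow, norm_pow]
    gcongr
  calc ‖kleinJ τ - 1 / modularQ τ‖ = ‖(kleinJ τ - (1 / modularQ τ + 744)) + 744‖ := by
        congr 1; ring
    _ ≤ _ := (norm_add_le _ _).trans (by simpa using hb)

theorem im_smul_le_of_abs_re_le_half {τ : ℍ} (hre : |τ.re| ≤ 1 / 2) (him : τ.im ≤ 1 / 4)
    (hS : (ModularGroup.S • τ).im ≤ 1 / 2) (γ : SL(2, ℤ)) :
    (γ • τ).im ≤ 1 / (4 * τ.im) := by
  have hy := τ.im_pos
  have key : ∀ {N : ℝ}, 4 * τ.im ^ 2 ≤ N → τ.im / N ≤ 1 / (4 * τ.im) := by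
    intro N hN
    have : 0 < N := lt_of_lt_of_le (by positivity) hN
    rw [div_le_div_iff₀ this (by positivity)]
    nlinarith
  have hden : ∀ g : SL(2, ℤ), Complex.normSq (denom g τ) =
      ((g 1 0 : ℝ) * τ.re + g 1 1) ^ 2 + ((g 1 0 : ℝ) * τ.im) ^ 2 := by
    intro g
    rw [ModularGroup.denom_apply, Complex.normSq_apply]
    simp
    ring
  rw [ModularGroup.im_smul_eq_div_normSq, hden] at hS ⊢
  have hdet := Matrix.det_fin_two γ.1
  rw [γ.2] at hdet
  obtain ⟨h1, h2⟩ := abs_le.1 hre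
  by_cases hc : |γ 1 0| ≤ 1
  · by_cases hd : γ 1 1 = 0
    · have hc1 : (γ 1 0 : ℝ) ^ 2 = 1 := by
        have : IsUnit (γ 1 0) := by
          refine isUnit_iff_dvd_one.2 ⟨-γ 0 1, ?_⟩
          rw [hd] at hdet
          linarith
        rcases Int.isUnit_iff.1 this with h | h <;> simp [h]
      have hS' : ((ModularGroup.S 1 0 : ℤ) : ℝ) = 1 ∧ ((ModularGroup.S 1 1 : ℤ) : ℝ) = 0 := by
        simp [ModularGroup.S]
      rw [hS'.1, hS'.2] at hS
      rw [hd]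
      have : ((γ 1 0 : ℝ) * τ.re + (0 : ℤ)) ^ 2 + ((γ 1 0 : ℝ) * τ.im) ^ 2 =
          (1 * τ.re + 0) ^ 2 + (1 * τ.im) ^ 2 := by
        push_cast
        linear_combination (τ.re ^ 2 + τ.im ^ 2) * hc1
      rw [this]
      refine hS.trans ?_
      rw [div_le_div_iff₀ (by norm_num) (by positivity)]
      linarith
    · refine key ?_
      have hd1 : (1 : ℝ) ≤ |(γ 1 1 : ℝ)| := by exact_mod_cast Int.one_le_abs hd
      have hc' : |(γ 1 0 : ℝ)| ≤ 1 := by exact_mod_cast hc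
      have hx : |(γ 1 0 : ℝ) * τ.re| ≤ 1 / 2 := by
        rw [abs_mul]
        nlinarith [abs_nonneg τ.re, abs_nonneg (γ 1 0 : ℝ)]
      have h3 : 1 / 2 ≤ |(γ 1 0 : ℝ) * τ.re + γ 1 1| := by
        have := abs_sub_abs_le_abs_sub (γ 1 1 : ℝ) (-((γ 1 0 : ℝ) * τ.re))
        rw [abs_neg, sub_neg_eq_add, add_comm (γ 1 1 : ℝ)] at this
        linarith
      have h4 : (1 / 4 : ℝ) ≤ ((γ 1 0 : ℝ) * τ.re + γ 1 1) ^ 2 := by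
        rw [← sq_abs]
        nlinarith
      nlinarith [sq_nonneg ((γ 1 0 : ℝ) * τ.im)]
  · refine key ?_
    have hc2 : (2 : ℝ) ≤ |(γ 1 0 : ℝ)| := by
      have : 2 ≤ |γ 1 0| := by omega
      exact_mod_cast this
    have hc4 : (4 : ℝ) ≤ (γ 1 0 : ℝ) ^ 2 := by
      rw [← sq_abs]
      nlinarith
    rw [mul_pow]
    nlinarith [sq_nonneg ((γ 1 0 : ℝ) * τ.re + γ 1 1),
      mul_le_mul_of_nonneg_right hc4 (sq_nonneg τ.im)]

theorem one_div_modularQ_S_smul (τ : ℍ) :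
    1 / modularQ (ModularGroup.S • τ) = Complex.exp (2 * Real.pi * Complex.I / τ) := by
  rw [modularQ, modular_S_smul, one_div, ← Complex.exp_neg]
  congr 1
  simp [div_eq_mul_inv]

theorem norm_one_div_modularQ (τ : ℍ) :
    ‖1 / modularQ τ‖ = Real.exp (2 * Real.pi * τ.im) := by
  rw [norm_div, norm_one, norm_modularQ, one_div, ← Real.exp_neg]
  congr 1
  ring

/-- Near the real line and within a period strip centred at `0`, the function `j` is dominated by
the exponential coming from the pole of `j` at the cusp `0`. -/
theorem exists_norm_kleinJ_sub_exp_le :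
    ∃ C : ℝ, 0 ≤ C ∧ ∀ τ : ℍ, |τ.re| ≤ 1 / 2 → τ.im ≤ 1 / 4 →
      ‖kleinJ τ - Complex.exp (2 * Real.pi * Complex.I / τ)‖ ≤
        C * Real.exp (Real.pi / (2 * τ.im)) := by
  obtain ⟨C, hC⟩ := exists_norm_kleinJ_sub_one_div_modularQ_le
  have hC0 : 0 ≤ C := (norm_nonneg _).trans (hC ⟨Complex.I, by simp⟩ (by
    change 1 / 2 ≤ Complex.I.im
    norm_num))
  refine ⟨C + 2, by positivity, fun τ hre him => ?_⟩
  have hy := τ.im_pos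
  have hexp : 1 ≤ Real.exp (Real.pi / (2 * τ.im)) := Real.one_le_exp (by positivity)
  rw [← one_div_modularQ_S_smul]
  rcases le_total (1 / 2) (ModularGroup.S • τ).im with hS | hS
  · rw [← kleinJ_smul ModularGroup.S τ]
    refine (hC _ hS).trans ?_
    nlinarith
  · obtain ⟨γ, hγ⟩ := ModularGroup.exists_one_half_le_im_smul τ
    have hle := im_smul_le_of_abs_re_le_half hre him hS γ
    have hm : ∀ {t : ℝ}, t ≤ 1 / (4 * τ.im) →
        Real.exp (2 * Real.pi * t) ≤ Real.exp (Real.pi / (2 * τ.im)) := by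
      intro t ht
      rw [Real.exp_le_exp]
      calc 2 * Real.pi * t ≤ 2 * Real.pi * (1 / (4 * τ.im)) := by gcongr
        _ = _ := by field_simp; norm_num
    have h1 : ‖1 / modularQ (γ • τ)‖ ≤ Real.exp (Real.pi / (2 * τ.im)) :=
      (norm_one_div_modularQ _).trans_le (hm hle)
    have h2 : ‖1 / modularQ (ModularGroup.S • τ)‖ ≤ Real.exp (Real.pi / (2 * τ.im)) :=
      (norm_one_div_modularQ _).trans_le (hm (im_smul_le_of_abs_re_le_half hre him hS _))
    have h3 := hC _ hγ
    rw [kleinJ_smul] at h3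
    calc ‖kleinJ τ - 1 / modularQ (ModularGroup.S • τ)‖
        = ‖(kleinJ τ - 1 / modularQ (γ • τ)) +
            (1 / modularQ (γ • τ) - 1 / modularQ (ModularGroup.S • τ))‖ := by
          rw [sub_add_sub_cancel]
      _ ≤ C + (Real.exp (Real.pi / (2 * τ.im)) + Real.exp (Real.pi / (2 * τ.im))) :=
          (norm_add_le _ _).trans (add_le_add h3 ((norm_sub_le _ _).trans (add_le_add h1 h2)))
      _ ≤ _ := by nlinarith

theorem re_neg_two_pi_sq_div (s v : ℝ) :
    (-(2 * Real.pi * v ^ 2) / (1 - Complex.I * (v / s)) : ℂ).re =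
      -(2 * Real.pi * (v ^ 2 / (1 + (v / s) ^ 2))) := by
  have h : (-(2 * Real.pi * v ^ 2) : ℂ) = ((-(2 * Real.pi * v ^ 2) : ℝ) : ℂ) := by push_cast; ring
  have h2 : (v / s : ℂ) = ((v / s : ℝ) : ℂ) := by push_cast; ring
  rw [h, h2, Complex.div_re, Complex.normSq_apply]
  simp [-Complex.ofReal_div, -Complex.ofReal_pow, -Complex.ofReal_mul, -Complex.ofReal_neg]
  ring

theorem one_sub_I_mul_ne_zero (x : ℝ) : (1 - Complex.I * x : ℂ) ≠ 0 := by
  intro h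
  simpa using congrArg Complex.re h

theorem exp_neg_le_eight_div_one_add_sq {s v : ℝ} (hs : 1 ≤ s) (hv : |v| ≤ s ^ 3 / 2) :
    Real.exp (-(2 * Real.pi * (v ^ 2 / (1 + (v / s) ^ 2)))) ≤ 8 * (1 + v ^ 2)⁻¹ := by
  have hs0 : 0 < s := by linarith
  set E := v ^ 2 / (1 + (v / s) ^ 2) with hE
  have hE0 : 0 ≤ E := by positivity
  have hexp : (1 + E) ^ 3 ≤ Real.exp (2 * Real.pi * E) := by
    calc (1 + E) ^ 3 ≤ Real.exp E ^ 3 := by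
          gcongr
          linarith [Real.add_one_le_exp E]
      _ = Real.exp (3 * E) := by rw [← Real.exp_nat_mul]; norm_num
      _ ≤ _ := by
          rw [Real.exp_le_exp]
          nlinarith [Real.pi_gt_three]
  have hpoly : 1 + v ^ 2 ≤ 8 * (1 + E) ^ 3 := by
    rcases le_total (v ^ 2) (s ^ 2) with h | h
    · have h1 : v ^ 2 / 2 ≤ E := by
        rw [hE]
        have : (v / s) ^ 2 ≤ 1 := by
          rw [div_pow]
          exact div_le_one_of_le₀ h (by positivity)
        gcongr
        linarith
      nlinarith [pow_nonneg hE0 2, pow_nonneg hE0 3]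
    · have h1 : s ^ 2 / 2 ≤ E := by
        rw [hE, div_le_div_iff₀ (by norm_num) (by positivity)]
        have : s ^ 2 * (v / s) ^ 2 = v ^ 2 := by field_simp
        nlinarith
      have h2 : v ^ 2 ≤ (s ^ 2) ^ 3 / 4 := by
        rw [← sq_abs]
        calc |v| ^ 2 ≤ (s ^ 3 / 2) ^ 2 := by gcongr
          _ = _ := by ring
      have h3 : (s ^ 2) ^ 3 ≤ 8 * E ^ 3 := by
        calc (s ^ 2) ^ 3 ≤ (2 * E) ^ 3 := by
              gcongr
              linarith
          _ = _ := by ring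
      nlinarith [pow_nonneg hE0 2, pow_nonneg hE0 3]
  rw [Real.exp_neg, ← div_eq_mul_inv, le_div_iff₀ (by positivity),
    inv_mul_le_iff₀ (Real.exp_pos _)]
  linarith

theorem integral_exp_neg_two_pi_sq :
    ∫ v : ℝ, Complex.exp (-(2 * Real.pi * v ^ 2)) = ((1 / Real.sqrt 2 : ℝ) : ℂ) := by
  have h := integral_gaussian (2 * Real.pi)
  have h2 : Real.pi / (2 * Real.pi) = 1 / 2 := by
    field_simp
  rw [h2, Real.sqrt_div zero_le_one, Real.sqrt_one] at h
  rw [← h, ← integral_complex_ofReal]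
  congr 1 with v
  push_cast
  congr 1
  ring

/-- Laplace's method for the integrals that arise at the saddle point. -/
theorem tendsto_integral_exp_saddle :
    Tendsto (fun s : ℝ => ∫ v in (-(s ^ 3 / 2))..(s ^ 3 / 2),
      Complex.exp (-(2 * Real.pi * v ^ 2) / (1 - Complex.I * (v / s)))) atTop
      (𝓝 ((1 / Real.sqrt 2 : ℝ) : ℂ)) := by
  rw [← integral_exp_neg_two_pi_sq]
  have hlim : Tendsto (fun s : ℝ => ∫ v : ℝ, (Set.Ioc (-(s ^ 3 / 2)) (s ^ 3 / 2)).indicator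
      (fun v : ℝ => Complex.exp (-(2 * Real.pi * v ^ 2) / (1 - Complex.I * (v / s)))) v) atTop
      (𝓝 (∫ v : ℝ, Complex.exp (-(2 * Real.pi * v ^ 2)))) := by
    refine tendsto_integral_filter_of_dominated_convergence (fun v => 8 * (1 + v ^ 2)⁻¹)
      ?_ ?_ (integrable_inv_one_add_sq.const_mul 8) ?_
    · filter_upwards [eventually_ge_atTop 1] with s hs
      refine (Continuous.aestronglyMeasurable ?_).indicator measurableSet_Ioc
      refine Complex.continuous_exp.comp (Continuous.div (by fun_prop) (by fun_prop) fun v => ?_)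
      simpa using one_sub_I_mul_ne_zero (v / s)
    · filter_upwards [eventually_ge_atTop 1] with s hs
      refine Eventually.of_forall fun v => ?_
      by_cases hv : v ∈ Set.Ioc (-(s ^ 3 / 2)) (s ^ 3 / 2)
      · rw [Set.indicator_of_mem hv, Complex.norm_exp, re_neg_two_pi_sq_div]
        exact exp_neg_le_eight_div_one_add_sq hs (abs_le.2 ⟨hv.1.le, hv.2⟩)
      · rw [Set.indicator_of_notMem hv, norm_zero]
        positivity
    · refine Eventually.of_forall fun v => ?_
      have h1 : Tendsto (fun s : ℝ => s ^ 3 / 2) atTop atTop :=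
        (tendsto_pow_atTop (by norm_num)).atTop_div_const (by norm_num)
      have h2 : Tendsto (fun s : ℝ => ((v / s : ℝ) : ℂ)) atTop (𝓝 0) :=
        (Complex.continuous_ofReal.tendsto' 0 0 (by simp)).comp
          (tendsto_const_nhds.div_atTop tendsto_id)
      have h3 : Tendsto (fun s : ℝ => Complex.exp
          (-(2 * Real.pi * v ^ 2) / (1 - Complex.I * (v / s)))) atTop
          (𝓝 (Complex.exp (-(2 * Real.pi * v ^ 2)))) := by
        have : Tendsto (fun s : ℝ =>
            (-(2 * Real.pi * v ^ 2) / (1 - Complex.I * ((v / s : ℝ) : ℂ)) : ℂ)) atTop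
            (𝓝 (-(2 * Real.pi * v ^ 2) / (1 - Complex.I * 0))) :=
          tendsto_const_nhds.div (tendsto_const_nhds.sub (h2.const_mul _)) (by simp)
        simpa [Function.comp_def] using (Complex.continuous_exp.tendsto _).comp this
      refine h3.congr' ?_
      filter_upwards [h1.eventually_gt_atTop |v|] with s hs
      rw [Set.indicator_of_mem]
      exact ⟨by linarith [neg_abs_le v], by linarith [le_abs_self v]⟩
  refine hlim.congr' ?_
  filter_upwards [eventually_ge_atTop 0] with s hs
  have : -(s ^ 3 / 2) ≤ s ^ 3 / 2 := by
    have : 0 ≤ s ^ 3 := by positivity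
    linarith
  rw [intervalIntegral.integral_of_le this, integral_indicator measurableSet_Ioc]

/-- The point `x + iy` of the upper half-plane. -/
noncomputable def horizontalPoint (y : ℝ) (hy : 0 < y) (x : ℝ) : ℍ :=
  ⟨x + y * Complex.I, by simpa using hy⟩

@[simp]
theorem coe_horizontalPoint (y : ℝ) (hy : 0 < y) (x : ℝ) :
    (horizontalPoint y hy x : ℂ) = x + y * Complex.I := rfl

@[simp]
theorem re_horizontalPoint (y : ℝ) (hy : 0 < y) (x : ℝ) : (horizontalPoint y hy x).re = x := by
  rw [← coe_re]
  simp

@[simp]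
theorem im_horizontalPoint (y : ℝ) (hy : 0 < y) (x : ℝ) : (horizontalPoint y hy x).im = y := by
  rw [← coe_im]
  simp

theorem continuous_horizontalPoint (y : ℝ) (hy : 0 < y) : Continuous (horizontalPoint y hy) := by
  rw [isEmbedding_coe.continuous_iff]
  change Continuous fun x : ℝ => (x + y * Complex.I : ℂ)
  fun_prop

theorem horizontalPoint_add_one (y : ℝ) (hy : 0 < y) (x : ℝ) :
    horizontalPoint y hy (x + 1) = (1 : ℝ) +ᵥ horizontalPoint y hy x := by
  ext
  simp
  ring

theorem continuous_modularQ : Continuous modularQ := by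
  unfold modularQ
  fun_prop

theorem continuous_kleinJ : Continuous kleinJ := by
  have h : kleinJ = fun τ => modularQMulKleinJ τ / modularQ τ := by
    funext τ
    have := modularQ_ne_zero τ
    rw [modularQMulKleinJ]
    field_simp
  rw [h]
  exact mdifferentiable_modularQMulKleinJ.continuous.div continuous_modularQ modularQ_ne_zero

theorem kleinJCoeff_eq_integral (n : ℕ) {y : ℝ} (hy : 0 < y) :
    kleinJCoeff n = ∫ x in (-(1 / 2 : ℝ))..(1 / 2),
      (1 / modularQ (horizontalPoint y hy x)) ^ n * kleinJ (horizontalPoint y hy x) := by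
  have h := qExpansion_coeff_eq_intervalIntegral one_pos periodic_modularQMulKleinJ
    mdifferentiable_modularQMulKleinJ isBoundedAtImInfty_modularQMulKleinJ (n + 1) hy
  have hper : Function.Periodic (fun x : ℝ =>
      (1 / modularQ (horizontalPoint y hy x)) ^ n * kleinJ (horizontalPoint y hy x)) 1 := by
    intro x
    simp only [horizontalPoint_add_one, modularQ_vadd_one, kleinJ_vadd_one]
  have hshift := hper.intervalIntegral_add_eq (-(1 / 2)) 0
  rw [show -(1 / 2 : ℝ) + 1 = 1 / 2 by norm_num, zero_add] at hshift
  rw [hshift]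
  refine h.trans ?_
  rw [Complex.ofReal_one, div_one, one_mul]
  congr 1 with x
  have hq := modularQ_ne_zero (horizontalPoint y hy x)
  have hq' : Function.Periodic.qParam 1 (x + y * Complex.I) = modularQ (horizontalPoint y hy x) :=
    (modularQ_eq_qParam (horizontalPoint y hy x)).symm
  change 1 / Function.Periodic.qParam 1 (x + y * Complex.I) ^ (n + 1) *
    modularQMulKleinJ (horizontalPoint y hy x) = _
  rw [hq', modularQMulKleinJ, one_div_pow]
  field_simp
  ring

theorem norm_integral_modularQ_mul_kleinJ_sub_le {C : ℝ}
    (hC : ∀ τ : ℍ, |τ.re| ≤ 1 / 2 → τ.im ≤ 1 / 4 →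
      ‖kleinJ τ - Complex.exp (2 * Real.pi * Complex.I / τ)‖ ≤
        C * Real.exp (Real.pi / (2 * τ.im)))
    (n : ℕ) {y : ℝ} (hy : 0 < y) (hy' : y ≤ 1 / 4) :
    ‖kleinJCoeff n - ∫ x in (-(1 / 2 : ℝ))..(1 / 2),
      (1 / modularQ (horizontalPoint y hy x)) ^ n *
        Complex.exp (2 * Real.pi * Complex.I / (horizontalPoint y hy x : ℂ))‖ ≤
      C * Real.exp (2 * Real.pi * n * y + Real.pi / (2 * y)) := by
  have hp := continuous_horizontalPoint y hy
  have hq : Continuous fun x : ℝ => (1 / modularQ (horizontalPoint y hy x)) ^ n :=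
    (continuous_const.div (continuous_modularQ.comp hp) fun _ => modularQ_ne_zero _).pow n
  have he : Continuous fun x : ℝ =>
      Complex.exp (2 * Real.pi * Complex.I / (horizontalPoint y hy x : ℂ)) :=
    Complex.continuous_exp.comp
      (continuous_const.div (continuous_coe.comp hp) fun x => ne_zero (horizontalPoint y hy x))
  have hj : Continuous fun x : ℝ => kleinJ (horizontalPoint y hy x) := continuous_kleinJ.comp hp
  rw [kleinJCoeff_eq_integral n hy, ← intervalIntegral.integral_sub
    ((hq.fun_mul hj).intervalIntegrable _ _) ((hq.fun_mul he).intervalIntegrable _ _)]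
  refine (intervalIntegral.norm_integral_le_of_norm_le_const fun x hx => ?_).trans_eq
    (b := C * Real.exp (2 * Real.pi * n * y + Real.pi / (2 * y)) * |1 / 2 - -(1 / 2)|) ?_
  · rw [Set.uIoc_of_le (by norm_num)] at hx
    have h := hC (horizontalPoint y hy x)
      (by rw [re_horizontalPoint]; exact abs_le.2 ⟨by linarith [hx.1], hx.2⟩)
      (by rwa [im_horizontalPoint])
    rw [im_horizontalPoint] at h
    rw [← mul_sub, norm_mul, norm_pow, norm_one_div_modularQ, im_horizontalPoint,
      ← Real.exp_nat_mul, Real.exp_add]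
    calc _ ≤ Real.exp (n * (2 * Real.pi * y)) * (C * Real.exp (Real.pi / (2 * y))) := by gcongr
      _ = _ := by
        rw [show (n : ℝ) * (2 * Real.pi * y) = 2 * Real.pi * n * y by ring]
        ring
  · norm_num

theorem integral_saddle_eq {n : ℕ} {s : ℝ} (hs : 0 < s) (hn : s ^ 4 = n)
    (hy : 0 < 1 / s ^ 2) :
    ∫ x in (-(1 / 2 : ℝ))..(1 / 2), (1 / modularQ (horizontalPoint (1 / s ^ 2) hy x)) ^ n *
        Complex.exp (2 * Real.pi * Complex.I / (horizontalPoint (1 / s ^ 2) hy x : ℂ)) =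
      (Real.exp (4 * Real.pi * s ^ 2) / s ^ 3 : ℝ) * ∫ v in (-(s ^ 3 / 2))..(s ^ 3 / 2),
        Complex.exp (-(2 * Real.pi * v ^ 2) / (1 - Complex.I * (v / s))) := by
  have hs3 : s ^ 3 ≠ 0 := by positivity
  have hsub := intervalIntegral.integral_comp_mul_left (a := -(1 / 2)) (b := 1 / 2) (fun v : ℝ =>
    Complex.exp (-(2 * Real.pi * v ^ 2) / (1 - Complex.I * (v / s)))) hs3
  rw [show s ^ 3 * -(1 / 2) = -(s ^ 3 / 2) by ring, show s ^ 3 * (1 / 2) = s ^ 3 / 2 by ring]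
    at hsub
  have hI : ∫ v in (-(s ^ 3 / 2))..(s ^ 3 / 2),
      Complex.exp (-(2 * Real.pi * v ^ 2) / (1 - Complex.I * (v / s))) =
      (s ^ 3 : ℝ) * ∫ x in (-(1 / 2 : ℝ))..(1 / 2),
        Complex.exp (-(2 * Real.pi * ((s ^ 3 * x : ℝ) : ℂ) ^ 2) /
          (1 - Complex.I * (((s ^ 3 * x : ℝ) : ℂ) / s))) := by
    rw [hsub, Complex.real_smul, ← mul_assoc, ← Complex.ofReal_mul, mul_inv_cancel₀ hs3,
      Complex.ofReal_one, one_mul]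
  rw [hI, ← mul_assoc, ← Complex.ofReal_mul, div_mul_cancel₀ _ hs3,
    ← intervalIntegral.integral_const_mul]
  congr 1 with x
  rw [modularQ, one_div, ← Complex.exp_neg, ← Complex.exp_nat_mul, Complex.ofReal_exp,
    ← Complex.exp_add, ← Complex.exp_add]
  congr 1
  have hnC : (n : ℂ) = (s : ℂ) ^ 4 := by exact_mod_cast hn.symm
  have hsC : (s : ℂ) ≠ 0 := by exact_mod_cast hs.ne'
  have hw : (1 - Complex.I * (s ^ 2 * x) : ℂ) ≠ 0 := by
    have := one_sub_I_mul_ne_zero (s ^ 2 * x)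
    push_cast at this
    exact this
  have hτ : ((horizontalPoint (1 / s ^ 2) hy x : ℍ) : ℂ) =
      Complex.I * (1 - Complex.I * (s ^ 2 * x)) / s ^ 2 := by
    rw [coe_horizontalPoint]
    push_cast
    field_simp
    linear_combination ((s : ℂ) ^ 2 * x) * Complex.I_sq
  have hv : (((s ^ 3 * x : ℝ) : ℂ) / s) = s ^ 2 * x := by
    push_cast
    field_simp
  rw [hτ, hnC, hv]
  set w : ℂ := 1 - Complex.I * (s ^ 2 * x) with hwdef
  have hw2 : ((s ^ 3 * x : ℝ) : ℂ) ^ 2 = -(s : ℂ) ^ 2 * (w - 1) ^ 2 := by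
    rw [hwdef]
    push_cast
    linear_combination (s : ℂ) ^ 6 * x ^ 2 * Complex.I_sq
  rw [hw2]
  push_cast
  have hI0 := Complex.I_ne_zero
  field_simp
  linear_combination (-2 * w ^ 2) * Complex.I_sq

theorem exists_norm_kleinJCoeff_div_sub_le :
    ∃ C : ℝ, ∀ (n : ℕ) (s : ℝ), 2 ≤ s → s ^ 4 = n →
      ‖kleinJCoeff n / (Real.exp (4 * Real.pi * s ^ 2) / s ^ 3 : ℝ) -
        ∫ v in (-(s ^ 3 / 2))..(s ^ 3 / 2),
          Complex.exp (-(2 * Real.pi * v ^ 2) / (1 - Complex.I * (v / s)))‖ ≤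
        C * (s ^ 3 * Real.exp (-s)) := by
  obtain ⟨C, hC0, hC⟩ := exists_norm_kleinJ_sub_exp_le
  refine ⟨C, fun n s hs2 hn => ?_⟩
  have hs : 0 < s := by linarith
  have hy : 0 < 1 / s ^ 2 := by positivity
  have hy' : 1 / s ^ 2 ≤ 1 / 4 := one_div_le_one_div_of_le (by norm_num) (by nlinarith)
  have h := norm_integral_modularQ_mul_kleinJ_sub_le hC n hy hy'
  rw [integral_saddle_eq hs hn hy] at h
  set A : ℝ := Real.exp (4 * Real.pi * s ^ 2) / s ^ 3 with hA
  have hA0 : 0 < A := by positivity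
  have hAC : (A : ℂ) ≠ 0 := by exact_mod_cast hA0.ne'
  rw [div_sub' hAC, norm_div, Complex.norm_of_nonneg hA0.le, div_le_iff₀ hA0]
  refine h.trans ?_
  have hexp : 2 * Real.pi * n * (1 / s ^ 2) + Real.pi / (2 * (1 / s ^ 2)) =
      5 / 2 * Real.pi * s ^ 2 := by
    rw [← hn]
    field_simp
    norm_num
  have hr : s ^ 3 * Real.exp (-s) * A = Real.exp (-s + 4 * Real.pi * s ^ 2) := by
    rw [hA, Real.exp_add]
    field_simp
  rw [hexp, mul_assoc C, hr]
  gcongr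
  nlinarith [mul_le_mul_of_nonneg_right Real.pi_gt_three.le (sq_nonneg s)]

theorem isEquivalent_kleinJCoeff :
    Asymptotics.IsEquivalent atTop kleinJCoeff
      (fun n : ℕ => ((Real.exp (4 * Real.pi * Real.sqrt n) /
        (Real.sqrt 2 * (n : ℝ) ^ (3 / 4 : ℝ)) : ℝ) : ℂ)) := by
  obtain ⟨C, hC⟩ := exists_norm_kleinJCoeff_div_sub_le
  let s : ℕ → ℝ := fun n => (n : ℝ) ^ (1 / 4 : ℝ)
  have hs : Tendsto s atTop atTop :=
    (tendsto_rpow_atTop (by norm_num)).comp tendsto_natCast_atTop_atTop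
  have hpow (n k : ℕ) : s n ^ k = (n : ℝ) ^ (1 / 4 * k : ℝ) :=
    (Real.rpow_mul_natCast n.cast_nonneg _ k).symm
  have h4 (n : ℕ) : s n ^ 4 = n := by rw [hpow]; norm_num
  have h3 (n : ℕ) : (n : ℝ) ^ (3 / 4 : ℝ) = s n ^ 3 := by rw [hpow]; norm_num
  have h2 (n : ℕ) : Real.sqrt n = s n ^ 2 := by rw [hpow, Real.sqrt_eq_rpow]; norm_num
  have hsub : Tendsto (fun n => kleinJCoeff n /
      (Real.exp (4 * Real.pi * s n ^ 2) / s n ^ 3 : ℝ) -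
        ∫ v in (-(s n ^ 3 / 2))..(s n ^ 3 / 2),
          Complex.exp (-(2 * Real.pi * v ^ 2) / (1 - Complex.I * (v / s n)))) atTop (𝓝 0) := by
    have hb : Tendsto (fun n => C * (s n ^ 3 * Real.exp (-s n))) atTop (𝓝 0) := by
      simpa [Function.comp_def] using
        ((Real.tendsto_pow_mul_exp_neg_atTop_nhds_zero 3).comp hs).const_mul C
    refine squeeze_zero_norm' ?_ hb
    filter_upwards [hs.eventually_ge_atTop 2] with n hn using hC n (s n) hn (h4 n)
  have hlim := hsub.add (tendsto_integral_exp_saddle.comp hs)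
  simp only [Function.comp_apply, sub_add_cancel, zero_add] at hlim
  have hlim2 := hlim.mul_const ((Real.sqrt 2 : ℝ) : ℂ)
  have h2ne : Real.sqrt 2 ≠ 0 := by positivity
  rw [← Complex.ofReal_mul, div_mul_cancel₀ _ h2ne, Complex.ofReal_one] at hlim2
  refine Asymptotics.isEquivalent_of_tendsto_one (hlim2.congr fun n => ?_)
  rw [Pi.div_apply, h2, h3]
  push_cast
  have h2C : ((Real.sqrt 2 : ℝ) : ℂ) ≠ 0 := by exact_mod_cast h2ne
  have hE := Complex.exp_ne_zero (4 * Real.pi * s n ^ 2)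
  rw [div_div_eq_mul_div, div_div_eq_mul_div]
  ring

theorem theorem3p2 :
    (∀ τ : UpperHalfPlane,
      HasSum (fun n : ℕ => kleinJCoeff (n + 1) * modularQ τ ^ (n + 1))
        (kleinJ τ - (1 / modularQ τ + 744))) ∧
    Asymptotics.IsEquivalent Filter.atTop kleinJCoeff
      (fun n : ℕ => ((Real.exp (4 * Real.pi * Real.sqrt n) /
        (Real.sqrt 2 * (n : ℝ) ^ (3 / 4 : ℝ)) : ℝ) : ℂ)) :=
  ⟨hasSum_kleinJCoeff, isEquivalent_kleinJCoeff⟩
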